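/- Let $M,K,N$ be positive integers and let $\mathcal X=\{\mathsf x_1,\dots,\mathsf x_M\}\subset\mathbb C$ be a constellation of $M$ distinct points with $\frac1M\sum_m\mathsf x_m=0$ and $\frac1M\sum_m|\mathsf x_m|^2=1$. For $\gamma\ge 0$ let $I(\gamma)$ be the mutual information, in bits, between $X$ and $Y=\sqrt\gamma\,X+Z$, where $X$ is uniform on $\mathcal X$ and $Z\sim\mathcal{CN}(0,1)$ is independent of $X$. Put $\mathsf{MMSE}(\gamma)=\frac{\mathrm d}{\mathrm d\gamma}I(\gamma)$ for $\gamma>0$, and write $\mathcal M[g;t]=\int_0^\infty x^{t-1}g(x)\,\mathrm dx$ for the Mellin transform. Let $\mathbf f=\frac1{\sqrt N}[\mathrm e^{-\mathrm j\theta_1},\dots,\mathrm e^{-\mathrm j\theta_N}]^{\mathsf T}$ with real $\theta_n$, let $\mathbf R_1,\dots,\mathbf R_K\in\mathbb C^{N\times N}$ be positive semidefinite with $\mathbf f^{\mathsf H}\mathbf R_k\mathbf f>0$ for all $k$, and let $\mathbf h_1,\dots,\mathbf h_K$ be independent with $\mathbf h_k\sim\mathcal{CN}(\mathbf 0,\mathbf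 R_k)$. For $\overline\gamma>0$ set $\gamma_k=\overline\gamma\,|\mathbf h_k^{\mathsf H}\mathbf f|^2$, let $\gamma_{\rm MRC}=\sum_{k=1}^K\gamma_k$ be the post-combining SNR of maximal ratio combining, and let $\mathrm{AMR}(\overline\gamma)=\mathbb E\{I(\gamma_{\rm MRC})\}$ be the cooperative average multicast rate. Then: 1. For every $\overline\gamma>0$, $\gamma_1,\dots,\gamma_K$ are independent and $\gamma_k$ is exponentially distributed with mean $\overline\gamma_k=\overline\gamma\,\mathbf f^{\mathsf H}\mathbf R_k\mathbf f$. 2. $I$ is differentiable on $(0,\infty)$, and the integral $\mathcal M[\mathsf{MMSE};K+1]$ converges absolutely and is positive, so that $$d_{\rm coop}=\left(\frac{K!\,\prod_{k=1}^K\mathbf f^{\mathsf H}\mathbf R_k\mathbf f}{\mathcal M[\mathsf{MMSE};K+1]}\right)^{1/K}\in(0,\infty).$$ 3. As $\overline\gamma\to\infty$, $\mathrm{AMR}(\overline\gamma)\simeq\log_2M-(d_{\rm coop}\overline\gamma)^{-K}$, in the sense that $$\lim_{\overline\gamma\to\infty}\frac{\log_2M-\mathrm{AMR}(\overline\gamma)}{(d_{\rm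 coop}\,\overline\gamma)^{-K}}=1 .$$ That is, the high-SNR behaviour of the AMR has the form $A-(G_{\mathsf c}\overline\gamma)^{-G_{\mathsf d}}$ with limit $A=\log_2M$, array gain $G_{\mathsf c}=d_{\rm coop}$ and diversity order $G_{\mathsf d}=K$. -/

import Mathlib

open MeasureTheory ProbabilityTheory Filter Topology
open scoped ComplexOrder

noncomputable section

namespace AnalogMulticast

/-- The standard circularly symmetric complex Gaussian law `CN(0,1)` on `ℂ`, with density
`π⁻¹ exp (-|z|²)`. -/
def stdComplexGaussian : Measure ℂ :=
  volume.withDensity fun z => ENNReal.ofReal (Real.pi⁻¹ * Real.exp (-‖z‖ ^ 2))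

/-- The random vector `h` has the circularly symmetric complex Gaussian law `CN(0, R)`, expressed
through its characteristic function `E exp (j Re (wᴴ h)) = exp (-(wᴴ R w) / 4)`, `w ∈ ℂᴺ`
(this also covers singular covariance matrices `R = E[h hᴴ]`). -/
structure IsComplexGaussian {Ω : Type*} [MeasurableSpace Ω] {N : ℕ}
    (h : Ω → Fin N → ℂ) (R : Matrix (Fin N) (Fin N) ℂ) (μ : Measure Ω) : Prop where
  aemeasurable : AEMeasurable h μ
  charFun_eq : ∀ w : Fin N → ℂ,
    ∫ ω, Complex.exp (Complex.I * ((star w ⬝ᵥ h ω).re : ℂ)) ∂μ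
      = Complex.exp (-((star w ⬝ᵥ R.mulVec w).re : ℂ) / 4)

/-- Mutual information, in bits, of a pair of random variables with the given joint law:
the Kullback-Leibler divergence of the joint law from the product of its marginals. -/
def mutualInfoBits {α β : Type*} [MeasurableSpace α] [MeasurableSpace β]
    (joint : Measure (α × β)) : ℝ :=
  (InformationTheory.klDiv joint (joint.fst.prod joint.snd)).toReal / Real.log 2

/-- Joint law of `(X, Y)`, where `X` is equiprobable on the constellation `x`, and
`Y = √γ X + N` with `N ∼ CN(0,1)` independent of `X`. -/
def channelLaw {M : ℕ} (x : Fin M → ℂ) (γ : ℝ) : Measure (ℂ × ℂ) :=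
  ((uniformOn (Set.univ : Set (Fin M))).prod stdComplexGaussian).map
    fun p => (x p.1, (Real.sqrt γ : ℂ) * x p.1 + p.2)

/-- `I_M^X(γ)`: mutual information (bits) of the Gaussian channel with SNR `γ` and equiprobable
inputs from the constellation `x`. -/
def constellationMI {M : ℕ} (x : Fin M → ℂ) (γ : ℝ) : ℝ :=
  mutualInfoBits (channelLaw x γ)

/-- The function `MMSE_M^X = d I_M^X / dγ`. -/
def mmse {M : ℕ} (x : Fin M → ℂ) (γ : ℝ) : ℝ :=
  deriv (constellationMI x) γ

/-- The integrand of the real Mellin transform. -/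
def mellinIntegrand (f : ℝ → ℝ) (t : ℝ) (x : ℝ) : ℝ := x ^ (t - 1) * f x

/-- The real Mellin transform `∫₀^∞ x^(t-1) f(x) dx`. -/
def realMellin (f : ℝ → ℝ) (t : ℝ) : ℝ :=
  ∫ x in Set.Ioi (0 : ℝ), mellinIntegrand f t x

/-- The analog beamforming vector with phase shifts `θ`. -/
def beamformer {N : ℕ} (θ : Fin N → ℝ) : Fin N → ℂ :=
  fun n => ((Real.sqrt N)⁻¹ : ℂ) * Complex.exp (-(Complex.I * (θ n : ℂ)))

/-- `fᴴ R f`, which is real for a Hermitian matrix `R`. -/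
def beamGain {N : ℕ} (f : Fin N → ℂ) (R : Matrix (Fin N) (Fin N) ℂ) : ℝ :=
  (star f ⬝ᵥ R.mulVec f).re

/-- Instantaneous received SNR `γ̄ |hᴴ f|²`. -/
def receivedSNR {N : ℕ} (f h : Fin N → ℂ) (γbar : ℝ) : ℝ :=
  γbar * ‖star h ⬝ᵥ f‖ ^ 2

/-- Post-combining SNR of maximal ratio combining: the sum of the received SNRs. -/
def mrcSNR {K N : ℕ} (f : Fin N → ℂ) (h : Fin K → Fin N → ℂ) (γbar : ℝ) : ℝ :=
  ∑ k, receivedSNR f (h k) γbar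

/-- The cooperative average multicast rate `E[I_M^X(γ_MRC)]` at average SNR `γ̄`. -/
def coopAMR {Ω : Type*} [MeasurableSpace Ω] (μ : Measure Ω) {M K N : ℕ} (x : Fin M → ℂ)
    (f : Fin N → ℂ) (h : Fin K → Ω → Fin N → ℂ) (γbar : ℝ) : ℝ :=
  ∫ ω, constellationMI x (mrcSNR f (fun k => h k ω) γbar) ∂μ

/-- The array gain `(K! ∏ₖ fᴴ Rₖ f / M[MMSE; K+1])^(1/K)`. -/
def coopArrayGain {M K N : ℕ} (x : Fin M → ℂ) (f : Fin N → ℂ)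
    (R : Fin K → Matrix (Fin N) (Fin N) ℂ) : ℝ :=
  ((K.factorial : ℝ) * (∏ k, beamGain f (R k)) / realMellin (mmse x) ((K : ℝ) + 1))
    ^ (1 / (K : ℝ))

/-- The performance metric `F` behaves at high SNR as `A - (Gc · SNR)^(-Gd)`, with relative error
tending to zero in the deviation from the limit `A`; `Gc` is the array gain and `Gd` the diversity
order. -/
def HasHighSNRForm (F : ℝ → ℝ) (A Gc Gd : ℝ) : Prop :=
  0 < Gc ∧ 0 < Gd ∧
    Asymptotics.IsEquivalent atTop (fun s => A - F s) (fun s => (Gc * s) ^ (-Gd))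

end AnalogMulticast

end

/-!
Write `H(s)` for the equivocation `H(X | Y)` of the channel `Y = s X + Z`. The joint law of `(X, Y)`
has an explicit density with respect to the product of its marginals, so the mutual information is
`I(γ) = log₂ M - H(√γ)` (`constellationMI_eq`), and everything reduces to `H`.

For a pair of symbols at distance `d`, the triangle inequality bounds the product of the noise
density and the square root of the likelihood ratio by `exp (-s² d² / 8) exp (-|z|² / 4)`. As
`log (1 + ∑ t) ≤ 2 ∑ √t`, and as a posterior probability is at most `√t`, both `H` and `H'` are
dominated by integrals of such products. Hence `H` is differentiable under the integral sign, and
`H` and `H'` decay like `exp (-c s²)` with `c > 0` fixed by the minimum distance of the constellation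
(`exists_equivocation_le`). An integration by parts then gives
`𝓜[MMSE; K + 1] = K ∫ γ^(K-1) H(√γ) dγ`, which is finite, and positive because `H > 0`
(`realMellin_mmse_eq`, `realMellin_mmse_pos`). The sign of the MMSE is never needed.

The projection `fᴴ hₖ` is identified by its characteristic function as a scaled `CN(0,1)` variable,
so `γₖ` is exponential with mean `γ̄ bₖ`, where `bₖ = fᴴ Rₖ f`
(`IsComplexGaussian.hasLaw_receivedSNR`). By independence
`log₂ M - AMR(γ̄) = γ̄^(-K) (∏ bₖ)⁻¹ ∫ H(√(∑ uₖ)) exp (-∑ uₖ / (γ̄ bₖ)) du`, integrated over the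
positive orthant. By dominated convergence the integral tends to `∫ H(√(∑ uₖ)) du`, which is
`∫ t^(K-1) / (K-1)! H(√t) dt = 𝓜[MMSE; K + 1] / K!` (`tendsto_lintegral_pi_expMeasure`,
`lintegral_pi_Ioi_comp_sum`).
-/

noncomputable section

namespace AnalogMulticast

/-! ### The complex Gaussian law -/

instance isProbabilityMeasure_stdComplexGaussian : IsProbabilityMeasure stdComplexGaussian := by
  have hint : Integrable fun z : ℂ => Real.pi⁻¹ * Real.exp (-‖z‖ ^ 2) := by
    have := (GaussianFourier.integrable_cexp_neg_mul_sq_norm_add (b := 1) (V := ℂ)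
      (by simp) 0 0).norm
    refine (this.const_mul Real.pi⁻¹).congr (ae_of_all _ fun z => ?_)
    simp only [Complex.norm_exp]
    norm_cast
    simp
  have hval : ∫ z : ℂ, Real.exp (-‖z‖ ^ 2) = Real.pi := by
    have := GaussianFourier.integral_cexp_neg_mul_sq_norm_add (b := 1) (V := ℂ) (by simp) 0 0
    simp only [Complex.finrank_real_complex] at this
    norm_num at this
    have h2 : ∀ z : ℂ, Complex.exp (-(‖z‖ : ℂ) ^ 2) = ((Real.exp (-‖z‖ ^ 2) : ℝ) : ℂ) := by
      intro z; push_cast; rfl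
    simp_rw [h2] at this
    rw [integral_complex_ofReal] at this
    exact_mod_cast this
  refine ⟨?_⟩
  rw [stdComplexGaussian, withDensity_apply _ MeasurableSet.univ, setLIntegral_univ,
    ← ofReal_integral_eq_lintegral_ofReal hint (ae_of_all _ fun z => by positivity),
    integral_const_mul, hval, inv_mul_cancel₀ Real.pi_ne_zero, ENNReal.ofReal_one]

/-- Expectations under `CN(0,1)` as weighted Lebesgue integrals. -/
lemma integral_stdComplexGaussian {E : Type*} [NormedAddCommGroup E] [NormedSpace ℝ E]
    (F : ℂ → E) :
    ∫ z, F z ∂stdComplexGaussian = ∫ z, (Real.pi⁻¹ * Real.exp (-‖z‖ ^ 2)) • F z := by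
  rw [stdComplexGaussian, integral_withDensity_eq_integral_toReal_smul (by fun_prop)
    (ae_of_all _ fun _ => ENNReal.ofReal_lt_top)]
  refine integral_congr_ae (ae_of_all _ fun z => ?_)
  simp only
  rw [ENNReal.toReal_ofReal (by positivity)]

lemma charFun_stdComplexGaussian (c : ℂ) :
    charFun stdComplexGaussian c = Complex.exp (-(‖c‖ ^ 2 : ℝ) / 4) := by
  rw [charFun_apply, integral_stdComplexGaussian]
  have key := GaussianFourier.integral_cexp_neg_mul_sq_norm_add (b := 1) (V := ℂ) (by simp)
    Complex.I c
  have h2 : ∀ z : ℂ, (Real.pi⁻¹ * Real.exp (-‖z‖ ^ 2)) •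
      Complex.exp ((inner ℝ z c : ℝ) * Complex.I) =
      (Real.pi : ℂ)⁻¹ * Complex.exp (-1 * (‖z‖ : ℂ) ^ 2 + Complex.I * (inner ℝ c z : ℝ)) := by
    intro z
    rw [Complex.real_smul, Complex.exp_add, real_inner_comm]
    push_cast
    ring_nf
  simp_rw [h2]
  rw [integral_const_mul, key, Complex.finrank_real_complex]
  norm_num

lemma expMeasure_eq_withDensity_restrict {r : ℝ} :
    expMeasure r = (volume.restrict (Set.Ioi 0)).withDensity
      fun u => ENNReal.ofReal (r * Real.exp (-(r * u))) := by
  rw [expMeasure, gammaMeasure, restrict_Ioi_eq_restrict_Ici,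
    ← withDensity_indicator measurableSet_Ici]
  congr 1
  funext u
  rcases le_or_gt 0 u with hu | hu
  · rw [Set.indicator_of_mem (Set.mem_Ici.2 hu)]
    exact exponentialPDF_of_nonneg hu
  · rw [Set.indicator_of_notMem (by simpa using hu), gammaPDF_of_neg hu]

/-- In polar coordinates `|z|²` has an exponential law under `CN(0,1)`. -/
lemma map_mul_norm_sq_stdComplexGaussian {c : ℝ} (hc : 0 < c) :
    stdComplexGaussian.map (fun z => c * ‖z‖ ^ 2) = expMeasure (1 / c) := by
  refine Measure.ext_of_lintegral _ fun F hF => ?_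
  rw [lintegral_map hF (by fun_prop), stdComplexGaussian,
    lintegral_withDensity_eq_lintegral_mul _ (by fun_prop) (by fun_prop),
    ← Complex.lintegral_comp_polarCoord_symm, polarCoord_target, Measure.volume_eq_prod,
    ← Measure.prod_restrict]
  simp only [Complex.norm_polarCoord_symm, Pi.mul_apply, sq_abs, smul_eq_mul]
  have hFm : Measurable fun p : ℝ × ℝ => F (c * p.1 ^ 2) := hF.comp (by fun_prop)
  rw [lintegral_prod _ (by fun_prop)]
  simp only [lintegral_const, Measure.restrict_apply MeasurableSet.univ, Set.univ_inter,
    Real.volume_Ioo]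
  have himg : (fun r : ℝ => c * r ^ 2) '' Set.Ioi 0 = Set.Ioi 0 := by
    ext u
    simp only [Set.mem_image, Set.mem_Ioi]
    constructor
    · rintro ⟨r, hr, rfl⟩; positivity
    · intro hu
      exact ⟨√(u / c), by positivity, by rw [Real.sq_sqrt (by positivity)]; field_simp⟩
  have hinj : Set.InjOn (fun r : ℝ => c * r ^ 2) (Set.Ioi 0) := by
    intro a ha b hb hab
    have hab' : a ^ 2 = b ^ 2 := mul_left_cancel₀ hc.ne' hab
    exact (sq_eq_sq₀ (le_of_lt ha) (le_of_lt hb)).1 hab'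
  rw [expMeasure_eq_withDensity_restrict,
    lintegral_withDensity_eq_lintegral_mul _ (by fun_prop) hF]
  simp only [Pi.mul_apply]
  have hder : ∀ r ∈ Set.Ioi (0 : ℝ), HasDerivWithinAt (fun r : ℝ => c * r ^ 2) (c * (2 * r))
      (Set.Ioi 0) r := fun r _ => by
    simpa using ((hasDerivAt_pow 2 r).const_mul c).hasDerivWithinAt
  conv_rhs =>
    rw [← himg, lintegral_image_eq_lintegral_abs_deriv_mul measurableSet_Ioi hder hinj]
  · refine setLIntegral_congr_fun measurableSet_Ioi fun r hr => ?_
    have hr : 0 < r := hr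
    have e1 : 1 / c * (c * r ^ 2) = r ^ 2 := by field_simp
    simp only [e1]
    rw [show ∀ a b d e : ENNReal, a * (b * d) * e = (a * b * e) * d by intros; ring,
      ← mul_assoc (ENNReal.ofReal |_|), ← ENNReal.ofReal_mul hr.le,
      ← ENNReal.ofReal_mul (by positivity), ← ENNReal.ofReal_mul (by positivity)]
    congr 2
    rw [abs_of_pos (by positivity)]
    have := Real.pi_ne_zero
    field_simp
    ring

/-! ### Branch SNRs of correlated Rayleigh channels -/

section Rayleigh

variable {Ω : Type*} [MeasurableSpace Ω] {μ : Measure Ω}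

/-- The projection `fᴴ h` of a complex Gaussian vector `h ∼ CN(0, R)` has the law of
`√(fᴴ R f) Z` with `Z ∼ CN(0,1)`. -/
lemma IsComplexGaussian.map_dotProduct [IsProbabilityMeasure μ] {N : ℕ} {h : Ω → Fin N → ℂ}
    {R : Matrix (Fin N) (Fin N) ℂ} (hh : IsComplexGaussian h R μ) (f : Fin N → ℂ)
    (hf : 0 ≤ beamGain f R) :
    μ.map (fun ω => star f ⬝ᵥ h ω) = stdComplexGaussian.map (fun z => √(beamGain f R) • z) := by
  have hm : AEMeasurable (fun ω => star f ⬝ᵥ h ω) μ :=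
    (Measurable.comp_aemeasurable (g := fun v : Fin N → ℂ => star f ⬝ᵥ v)
      (by unfold dotProduct; fun_prop) hh.aemeasurable)
  have := Measure.isProbabilityMeasure_map hm
  have : IsProbabilityMeasure (stdComplexGaussian.map (fun z => √(beamGain f R) • z)) :=
    Measure.isProbabilityMeasure_map (by fun_prop)
  refine Measure.ext_of_charFun (funext fun c => ?_)
  rw [charFun_map_smul, charFun_stdComplexGaussian, charFun_apply,
    integral_map hm (by fun_prop)]
  have key := hh.charFun_eq (c • f)
  have h1 : ∀ v : Fin N → ℂ, star (c • f) ⬝ᵥ v = star c * (star f ⬝ᵥ v) := by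
    intro v; rw [star_smul, smul_dotProduct, smul_eq_mul]
  have h2 : (star (c • f) ⬝ᵥ R.mulVec (c • f)).re = ‖√(beamGain f R) • c‖ ^ 2 := by
    rw [h1, Matrix.mulVec_smul, dotProduct_smul, smul_eq_mul, ← mul_assoc, norm_smul, mul_pow,
      Real.norm_eq_abs, sq_abs, Real.sq_sqrt hf, beamGain,
      show star c * c = ((‖c‖ ^ 2 : ℝ) : ℂ) by
        rw [← Complex.normSq_eq_norm_sq, Complex.normSq_eq_conj_mul_self]; rfl,
      Complex.re_ofReal_mul, mul_comm]
  rw [h2] at key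
  rw [← key]
  refine integral_congr_ae (ae_of_all _ fun ω => ?_)
  simp only
  rw [h1, real_inner_comm, Complex.inner, mul_comm (star c)]
  rw [mul_comm]
  rfl

lemma receivedSNR_eq {N : ℕ} (f v : Fin N → ℂ) (s : ℝ) :
    receivedSNR f v s = s * ‖star f ⬝ᵥ v‖ ^ 2 := by
  rw [receivedSNR, ← norm_star (star v ⬝ᵥ f), Matrix.star_dotProduct, star_star]

lemma measurable_receivedSNR {N : ℕ} (f : Fin N → ℂ) (s : ℝ) :
    Measurable fun v => receivedSNR f v s := by
  simp only [receivedSNR_eq, dotProduct]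
  fun_prop

/-- The branch SNR of a correlated Rayleigh channel is exponentially distributed. -/
lemma IsComplexGaussian.hasLaw_receivedSNR [IsProbabilityMeasure μ] {N : ℕ} {h : Ω → Fin N → ℂ}
    {R : Matrix (Fin N) (Fin N) ℂ} (hh : IsComplexGaussian h R μ) {f : Fin N → ℂ}
    (hf : 0 < beamGain f R) {s : ℝ} (hs : 0 < s) :
    HasLaw (fun ω => receivedSNR f (h ω) s) (expMeasure (1 / (s * beamGain f R))) μ := by
  have hm : AEMeasurable (fun ω => star f ⬝ᵥ h ω) μ :=
    (Measurable.comp_aemeasurable (g := fun v : Fin N → ℂ => star f ⬝ᵥ v)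
      (by unfold dotProduct; fun_prop) hh.aemeasurable)
  refine ⟨(measurable_receivedSNR f s).comp_aemeasurable hh.aemeasurable, ?_⟩
  simp only [receivedSNR_eq]
  have e : (fun ω => s * ‖star f ⬝ᵥ h ω‖ ^ 2) =
      (fun z : ℂ => s * ‖z‖ ^ 2) ∘ (fun ω => star f ⬝ᵥ h ω) := rfl
  rw [e, ← AEMeasurable.map_map_of_aemeasurable (by fun_prop) hm, hh.map_dotProduct f hf.le,
    Measure.map_map (by fun_prop) (by fun_prop),
    ← map_mul_norm_sq_stdComplexGaussian (mul_pos hs hf)]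
  congr 1
  funext z
  simp only [Function.comp_apply, norm_smul, mul_pow, Real.norm_eq_abs, sq_abs,
    Real.sq_sqrt hf.le]
  ring

end Rayleigh

/-! ### Differentiability and decay of the equivocation -/

/-- The likelihood ratio `φ(z + s d) / φ(z)` of the `CN(0,1)` density `φ`. -/
def pairRatio (d : ℂ) (s : ℝ) (z : ℂ) : ℝ := Real.exp (‖z‖ ^ 2 - ‖z + s • d‖ ^ 2)

/-- The sum over the constellation of the likelihoods of the output `s x_m + z`, relative to the
likelihood of the symbol `x_m` actually sent. Its inverse is the posterior probability of `x_m`. -/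
def likelihoodSum {M : ℕ} (x : Fin M → ℂ) (m : Fin M) (s : ℝ) (z : ℂ) : ℝ :=
  ∑ m', pairRatio (x m - x m') s z

/-- The derivative of `s ↦ log (likelihoodSum x m s z)`. -/
def logLikelihoodDeriv {M : ℕ} (x : Fin M → ℂ) (m : Fin M) (s : ℝ) (z : ℂ) : ℝ :=
  (∑ m', pairRatio (x m - x m') s z *
    (-(2 * inner ℝ (z + s • (x m - x m')) (x m - x m')))) / likelihoodSum x m s z

/-- The conditional entropy `H(X | Y)` in bits, for `X` equiprobable on `x` and `Y = s X + Z`,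
as a function of the channel amplitude `s`. -/
def equivocation {M : ℕ} (x : Fin M → ℂ) (s : ℝ) : ℝ :=
  (M * Real.log 2)⁻¹ * ∑ m, ∫ z, Real.log (likelihoodSum x m s z) ∂stdComplexGaussian

lemma pairRatio_pos (d : ℂ) (s : ℝ) (z : ℂ) : 0 < pairRatio d s z := Real.exp_pos _

/-- Since `|s d| ≤ |z + s d| + |z|`, the geometric mean of the densities at `z` and `z + s d` decays
like a Gaussian in both the noise and the amplitude. -/
lemma sqrt_pairRatio_mul_exp_le (d : ℂ) (s : ℝ) (z : ℂ) :
    √(pairRatio d s z) * Real.exp (-‖z‖ ^ 2) ≤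
      Real.exp (-((|s| * ‖d‖) ^ 2 / 8)) * Real.exp (-(‖z‖ ^ 2 / 4)) := by
  rw [pairRatio, ← Real.exp_half, ← Real.exp_add, ← Real.exp_add, Real.exp_le_exp]
  have h1 : |s| * ‖d‖ ≤ ‖z + s • d‖ + ‖z‖ := by
    have := norm_sub_le (z + s • d) z
    rwa [add_sub_cancel_left, norm_smul, Real.norm_eq_abs] at this
  have h2 : (|s| * ‖d‖) ^ 2 ≤ (‖z + s • d‖ + ‖z‖) ^ 2 := pow_le_pow_left₀ (by positivity) h1 2
  nlinarith [sq_nonneg (‖z + s • d‖ - ‖z‖), sq_nonneg ‖z + s • d‖]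

lemma integrable_exp_neg_mul_norm_sq {b : ℝ} (hb : 0 < b) :
    Integrable fun z : ℂ => Real.exp (-(‖z‖ ^ 2 / b)) := by
  have := (GaussianFourier.integrable_cexp_neg_mul_sq_norm_add (b := ((b⁻¹ : ℝ) : ℂ)) (V := ℂ)
    (by simpa using hb) 0 0).norm
  refine this.congr (ae_of_all _ fun z => ?_)
  simp only [Complex.norm_exp]
  norm_cast
  simp [div_eq_inv_mul]

lemma hasDerivAt_pairRatio (d : ℂ) (s : ℝ) (z : ℂ) :
    HasDerivAt (fun s => pairRatio d s z)
      (pairRatio d s z * (-(2 * inner ℝ (z + s • d) d))) s := by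
  have h1 : HasDerivAt (fun s : ℝ => z + s • d) d s := by
    simpa using ((hasDerivAt_id s).smul_const d).const_add z
  exact (h1.norm_sq.const_sub _).exp

section Constellation

variable {M : ℕ} (x : Fin M → ℂ) (m : Fin M)

lemma likelihoodSum_eq (s : ℝ) (z : ℂ) :
    likelihoodSum x m s z =
      1 + ∑ m' ∈ Finset.univ.erase m, pairRatio (x m - x m') s z := by
  rw [likelihoodSum, ← Finset.add_sum_erase _ _ (Finset.mem_univ m)]
  simp [pairRatio]

lemma one_le_likelihoodSum (s : ℝ) (z : ℂ) : 1 ≤ likelihoodSum x m s z := by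
  rw [likelihoodSum_eq]
  exact le_add_of_nonneg_right (Finset.sum_nonneg fun _ _ => (pairRatio_pos _ _ _).le)

lemma log_likelihoodSum_nonneg (s : ℝ) (z : ℂ) : 0 ≤ Real.log (likelihoodSum x m s z) :=
  Real.log_nonneg (one_le_likelihoodSum x m s z)

lemma log_likelihoodSum_le (s : ℝ) (z : ℂ) :
    Real.log (likelihoodSum x m s z) ≤
      2 * ∑ m' ∈ Finset.univ.erase m, √(pairRatio (x m - x m') s z) := by
  set T := ∑ m' ∈ Finset.univ.erase m, √(pairRatio (x m - x m') s z) with hT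
  have hT0 : 0 ≤ T := Finset.sum_nonneg fun _ _ => Real.sqrt_nonneg _
  have h1 : likelihoodSum x m s z ≤ (1 + T) ^ 2 := by
    have h2 : ∑ m' ∈ Finset.univ.erase m, (√(pairRatio (x m - x m') s z)) ^ 2 ≤ T ^ 2 :=
      Finset.sum_sq_le_sq_sum_of_nonneg fun _ _ => Real.sqrt_nonneg _
    rw [likelihoodSum_eq]
    simp_rw [Real.sq_sqrt (pairRatio_pos _ _ _).le] at h2
    nlinarith
  have h0 := one_le_likelihoodSum x m s z
  calc Real.log (likelihoodSum x m s z) ≤ Real.log ((1 + T) ^ 2) :=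
        Real.log_le_log (by linarith) h1
    _ = 2 * Real.log (1 + T) := by rw [Real.log_pow]; norm_num
    _ ≤ 2 * T := by linarith [Real.log_le_sub_one_of_pos (show 0 < 1 + T by linarith)]

lemma continuous_likelihoodSum (s : ℝ) : Continuous (likelihoodSum x m s) := by
  unfold likelihoodSum pairRatio
  fun_prop

lemma continuous_log_likelihoodSum (s : ℝ) :
    Continuous fun z => Real.log (likelihoodSum x m s z) :=
  (continuous_likelihoodSum x m s).log fun z =>
    (lt_of_lt_of_le one_pos (one_le_likelihoodSum x m s z)).ne'

lemma continuous_logLikelihoodDeriv (s : ℝ) : Continuous (logLikelihoodDeriv x m s) := by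
  refine Continuous.div ?_ (continuous_likelihoodSum x m s) fun z =>
    (lt_of_lt_of_le one_pos (one_le_likelihoodSum x m s z)).ne'
  unfold pairRatio
  fun_prop

lemma hasDerivAt_log_likelihoodSum (s : ℝ) (z : ℂ) :
    HasDerivAt (fun s => Real.log (likelihoodSum x m s z)) (logLikelihoodDeriv x m s z) s :=
  (HasDerivAt.fun_sum fun m' _ => hasDerivAt_pairRatio (x m - x m') s z).log
    (lt_of_lt_of_le one_pos (one_le_likelihoodSum x m s z)).ne'

/-- Gaussian decay of the equivocation integrand, jointly in the amplitude and in the noise. -/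
lemma log_likelihoodSum_mul_exp_le (s : ℝ) (z : ℂ) :
    Real.log (likelihoodSum x m s z) * Real.exp (-‖z‖ ^ 2) ≤
      (∑ m' ∈ Finset.univ.erase m, 2 * Real.exp (-((|s| * ‖x m - x m'‖) ^ 2 / 16))) *
        Real.exp (-(‖z‖ ^ 2 / 8)) := by
  refine (mul_le_mul_of_nonneg_right (log_likelihoodSum_le x m s z) (Real.exp_pos _).le).trans ?_
  rw [mul_assoc, Finset.sum_mul, Finset.mul_sum, Finset.sum_mul]
  refine Finset.sum_le_sum fun m' _ => ?_
  rw [mul_assoc]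
  refine mul_le_mul_of_nonneg_left ((sqrt_pairRatio_mul_exp_le _ s z).trans ?_) (by norm_num)
  gcongr <;> norm_num

/-- The term `m' = m` of the derivative vanishes, so only pairs of distinct symbols contribute to
the bound. -/
lemma abs_logLikelihoodDeriv_mul_exp_le (s : ℝ) (z : ℂ) :
    |logLikelihoodDeriv x m s z| * Real.exp (-‖z‖ ^ 2) ≤
      (∑ m' ∈ Finset.univ.erase m,
        12 * ‖x m - x m'‖ * Real.exp (-((|s| * ‖x m - x m'‖) ^ 2 / 16))) *
        Real.exp (-(‖z‖ ^ 2 / 8)) := by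
  have hS := one_le_likelihoodSum x m s z
  have hS0 : 0 < likelihoodSum x m s z := by linarith
  rw [logLikelihoodDeriv, abs_div, abs_of_pos hS0, ← Finset.add_sum_erase _ _ (Finset.mem_univ m)]
  simp only [sub_self, inner_zero_right, mul_zero, neg_zero, zero_add]
  refine (mul_le_mul_of_nonneg_right (div_le_div_of_nonneg_right
    (Finset.abs_sum_le_sum_abs _ _) hS0.le) (Real.exp_pos _).le).trans ?_
  rw [Finset.sum_div, Finset.sum_mul, Finset.sum_mul]
  refine Finset.sum_le_sum fun m' _ => ?_
  set d := x m - x m' with hd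
  set p := |s| * ‖d‖ with hp
  have hp0 : 0 ≤ p := by positivity
  have h1 : |pairRatio d s z * -(2 * inner ℝ (z + s • d) d)| ≤
      pairRatio d s z * (2 * ((‖z‖ + p) * ‖d‖)) := by
    rw [abs_mul, abs_neg, abs_mul, abs_of_pos (pairRatio_pos _ _ _), abs_two]
    gcongr
    · exact (pairRatio_pos _ _ _).le
    · refine (abs_real_inner_le_norm _ _).trans ?_
      gcongr
      refine (norm_add_le _ _).trans ?_
      rw [norm_smul, Real.norm_eq_abs]
  -- a posterior probability `t / S` is at most `√t`, because `S ≥ max 1 t`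
  have h2 : pairRatio d s z / likelihoodSum x m s z ≤ √(pairRatio d s z) := by
    have ht : pairRatio d s z ≤ likelihoodSum x m s z :=
      Finset.single_le_sum (f := fun m' => pairRatio (x m - x m') s z)
        (fun _ _ => (pairRatio_pos _ _ _).le) (Finset.mem_univ m')
    rw [div_le_iff₀ hS0]
    have h3 : √(pairRatio d s z) ≤ likelihoodSum x m s z := by
      rw [Real.sqrt_le_left (by linarith)]
      nlinarith
    calc pairRatio d s z = √(pairRatio d s z) * √(pairRatio d s z) :=
          (Real.mul_self_sqrt (pairRatio_pos _ _ _).le).symm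
      _ ≤ _ := by gcongr
  -- the linear factors `|z|` and `p` are absorbed by weakening the Gaussian exponents
  have e1 : ‖z‖ * Real.exp (-(‖z‖ ^ 2 / 4)) ≤ 2 * Real.exp (-(‖z‖ ^ 2 / 8)) := by
    have h : ‖z‖ ≤ 2 * Real.exp (‖z‖ ^ 2 / 8) := by
      nlinarith [Real.add_one_le_exp (‖z‖ ^ 2 / 8), sq_nonneg (‖z‖ / 2 - 1)]
    calc _ ≤ 2 * Real.exp (‖z‖ ^ 2 / 8) * Real.exp (-(‖z‖ ^ 2 / 4)) := by gcongr
      _ = _ := by rw [mul_assoc, ← Real.exp_add]; ring_nf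
  have e2 : p * Real.exp (-(p ^ 2 / 8)) ≤ 4 * Real.exp (-(p ^ 2 / 16)) := by
    have h : p ≤ 4 * Real.exp (p ^ 2 / 16) := by
      nlinarith [Real.add_one_le_exp (p ^ 2 / 16), sq_nonneg (p / 2 - 1)]
    calc _ ≤ 4 * Real.exp (p ^ 2 / 16) * Real.exp (-(p ^ 2 / 8)) := by gcongr
      _ = _ := by rw [mul_assoc, ← Real.exp_add]; ring_nf
  have e3 : Real.exp (-(p ^ 2 / 8)) ≤ Real.exp (-(p ^ 2 / 16)) := by gcongr; norm_num
  have e4 : Real.exp (-(‖z‖ ^ 2 / 4)) ≤ Real.exp (-(‖z‖ ^ 2 / 8)) := by gcongr; norm_num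
  calc |pairRatio d s z * -(2 * inner ℝ (z + s • d) d)| / likelihoodSum x m s z *
        Real.exp (-‖z‖ ^ 2)
      ≤ pairRatio d s z * (2 * ((‖z‖ + p) * ‖d‖)) / likelihoodSum x m s z *
        Real.exp (-‖z‖ ^ 2) := by gcongr
    _ = (pairRatio d s z / likelihoodSum x m s z) * Real.exp (-‖z‖ ^ 2) *
        (2 * ((‖z‖ + p) * ‖d‖)) := by ring
    _ ≤ √(pairRatio d s z) * Real.exp (-‖z‖ ^ 2) * (2 * ((‖z‖ + p) * ‖d‖)) := by gcongr
    _ ≤ Real.exp (-(p ^ 2 / 8)) * Real.exp (-(‖z‖ ^ 2 / 4)) * (2 * ((‖z‖ + p) * ‖d‖)) := by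
        exact mul_le_mul_of_nonneg_right (sqrt_pairRatio_mul_exp_le d s z) (by positivity)
    _ = 2 * ‖d‖ * (Real.exp (-(p ^ 2 / 8)) * (‖z‖ * Real.exp (-(‖z‖ ^ 2 / 4))) +
        (p * Real.exp (-(p ^ 2 / 8))) * Real.exp (-(‖z‖ ^ 2 / 4))) := by ring
    _ ≤ 2 * ‖d‖ * (Real.exp (-(p ^ 2 / 16)) * (2 * Real.exp (-(‖z‖ ^ 2 / 8))) +
        (4 * Real.exp (-(p ^ 2 / 16))) * Real.exp (-(‖z‖ ^ 2 / 8))) := by gcongr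
    _ = _ := by ring

lemma integrable_log_likelihoodSum (s : ℝ) :
    Integrable (fun z => Real.log (likelihoodSum x m s z)) stdComplexGaussian := by
  rw [stdComplexGaussian, integrable_withDensity_iff (by fun_prop)
    (ae_of_all _ fun _ => ENNReal.ofReal_lt_top)]
  refine ((integrable_exp_neg_mul_norm_sq (b := 8) (by norm_num)).const_mul (Real.pi⁻¹ *
    ∑ m' ∈ Finset.univ.erase m, 2 * Real.exp (-((|s| * ‖x m - x m'‖) ^ 2 / 16)))).mono' ?_ ?_
  · exact ((continuous_log_likelihoodSum x m s).measurable.mul (by fun_prop)).aestronglyMeasurable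
  · refine ae_of_all _ fun z => ?_
    have h0 := log_likelihoodSum_nonneg x m s z
    rw [ENNReal.toReal_ofReal (by positivity), Real.norm_of_nonneg (by positivity)]
    have := mul_le_mul_of_nonneg_left (log_likelihoodSum_mul_exp_le x m s z)
      (inv_pos.2 Real.pi_pos).le
    linarith

lemma integral_log_likelihoodSum_le (s : ℝ) :
    ∫ z, Real.log (likelihoodSum x m s z) ∂stdComplexGaussian ≤
      (∑ m' ∈ Finset.univ.erase m, 2 * Real.exp (-((|s| * ‖x m - x m'‖) ^ 2 / 16))) *
        (Real.pi⁻¹ * ∫ z : ℂ, Real.exp (-(‖z‖ ^ 2 / 8))) := by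
  rw [integral_stdComplexGaussian, ← integral_const_mul, ← integral_const_mul]
  refine integral_mono_of_nonneg (ae_of_all _ fun z => ?_)
    (((integrable_exp_neg_mul_norm_sq (b := 8) (by norm_num)).const_mul _).const_mul _)
    (ae_of_all _ fun z => ?_)
  · exact smul_nonneg (by positivity) (log_likelihoodSum_nonneg x m s z)
  · have := mul_le_mul_of_nonneg_left (log_likelihoodSum_mul_exp_le x m s z)
      (inv_pos.2 Real.pi_pos).le
    simp only [smul_eq_mul]
    linarith

/-- Differentiation of the equivocation under the Gaussian integral. -/
lemma hasDerivAt_integral_log_likelihoodSum (s : ℝ) :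
    HasDerivAt (fun s => ∫ z, Real.log (likelihoodSum x m s z) ∂stdComplexGaussian)
      (∫ z, logLikelihoodDeriv x m s z ∂stdComplexGaussian) s := by
  simp_rw [integral_stdComplexGaussian]
  have hw : Continuous fun z : ℂ => Real.pi⁻¹ * Real.exp (-‖z‖ ^ 2) := by fun_prop
  refine (hasDerivAt_integral_of_dominated_loc_of_deriv_le (s := Set.univ)
    (F := fun s z => (Real.pi⁻¹ * Real.exp (-‖z‖ ^ 2)) • Real.log (likelihoodSum x m s z))
    (F' := fun s z => (Real.pi⁻¹ * Real.exp (-‖z‖ ^ 2)) • logLikelihoodDeriv x m s z)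
    (bound := fun z : ℂ => Real.pi⁻¹ * ((∑ m' ∈ Finset.univ.erase m, 12 * ‖x m - x m'‖) *
      Real.exp (-(‖z‖ ^ 2 / 8)))) univ_mem ?_ ?_ ?_ ?_ ?_ ?_).2
  · exact Eventually.of_forall fun s =>
      (hw.smul (continuous_log_likelihoodSum x m s)).aestronglyMeasurable
  · have := integrable_log_likelihoodSum x m s
    rw [stdComplexGaussian, integrable_withDensity_iff_integrable_smul' (by fun_prop)
      (ae_of_all _ fun _ => ENNReal.ofReal_lt_top)] at this
    refine this.congr (ae_of_all _ fun z => ?_)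
    simp only
    rw [ENNReal.toReal_ofReal (by positivity)]
  · exact (hw.smul (continuous_logLikelihoodDeriv x m s)).aestronglyMeasurable
  · refine ae_of_all _ fun z s _ => ?_
    rw [norm_smul, Real.norm_of_nonneg (by positivity), Real.norm_eq_abs, mul_assoc,
      mul_comm (Real.exp _)]
    refine mul_le_mul_of_nonneg_left ((abs_logLikelihoodDeriv_mul_exp_le x m s z).trans ?_)
      (by positivity)
    refine mul_le_mul_of_nonneg_right (Finset.sum_le_sum fun m' _ => ?_) (Real.exp_pos _).le
    exact mul_le_of_le_one_right (by positivity) (Real.exp_le_one_iff.2 (by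
      have : 0 ≤ (|s| * ‖x m - x m'‖) ^ 2 := by positivity
      linarith))
  · exact ((integrable_exp_neg_mul_norm_sq (b := 8) (by norm_num)).const_mul _).const_mul _
  · exact ae_of_all _ fun z s _ => (hasDerivAt_log_likelihoodSum x m s z).const_mul _

lemma abs_integral_logLikelihoodDeriv_le (s : ℝ) :
    |∫ z, logLikelihoodDeriv x m s z ∂stdComplexGaussian| ≤
      (∑ m' ∈ Finset.univ.erase m,
        12 * ‖x m - x m'‖ * Real.exp (-((|s| * ‖x m - x m'‖) ^ 2 / 16))) *
        (Real.pi⁻¹ * ∫ z : ℂ, Real.exp (-(‖z‖ ^ 2 / 8))) := by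
  rw [integral_stdComplexGaussian, ← integral_const_mul, ← integral_const_mul,
    ← Real.norm_eq_abs]
  refine norm_integral_le_of_norm_le
    (((integrable_exp_neg_mul_norm_sq (b := 8) (by norm_num)).const_mul _).const_mul _)
    (ae_of_all _ fun z => ?_)
  rw [norm_smul, Real.norm_of_nonneg (by positivity), Real.norm_eq_abs]
  have := mul_le_mul_of_nonneg_left (abs_logLikelihoodDeriv_mul_exp_le x m s z)
      (inv_pos.2 Real.pi_pos).le
  linarith

lemma hasDerivAt_equivocation (s : ℝ) :
    HasDerivAt (equivocation x)
      ((M * Real.log 2)⁻¹ * ∑ m, ∫ z, logLikelihoodDeriv x m s z ∂stdComplexGaussian) s :=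
  (HasDerivAt.fun_sum fun m _ => hasDerivAt_integral_log_likelihoodSum x m s).const_mul _

lemma continuous_equivocation : Continuous (equivocation x) :=
  continuous_iff_continuousAt.2 fun s => (hasDerivAt_equivocation x s).continuousAt

lemma exists_pos_le_norm_sub (hx : Function.Injective x) :
    ∃ δ : ℝ, 0 < δ ∧ ∀ m m', m' ≠ m → δ ≤ ‖x m - x m'‖ := by
  classical
  rcases (Finset.univ : Finset (Fin M)).offDiag.eq_empty_or_nonempty with h | h
  · refine ⟨1, one_pos, fun m m' hm => ?_⟩
    have : (m, m') ∈ (Finset.univ : Finset (Fin M)).offDiag :=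
      Finset.mem_offDiag.2 ⟨Finset.mem_univ _, Finset.mem_univ _, hm.symm⟩
    exact absurd (h ▸ this) (Finset.notMem_empty _)
  · obtain ⟨q, hq, hmin⟩ := Finset.exists_min_image _ (fun q : Fin M × Fin M => ‖x q.1 - x q.2‖) h
    have hne : q.1 ≠ q.2 := (Finset.mem_offDiag.1 hq).2.2
    exact ⟨_, norm_pos_iff.2 (sub_ne_zero.2 (hx.ne hne)),
      fun m m' hm => hmin (m, m')
        (Finset.mem_offDiag.2 ⟨Finset.mem_univ _, Finset.mem_univ _, hm.symm⟩)⟩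

/-- The equivocation and its derivative decay like a Gaussian in the amplitude, at a rate set by
the minimum distance of the constellation. -/
lemma exists_equivocation_le (hx : Function.Injective x) :
    ∃ C c : ℝ, 0 < C ∧ 0 < c ∧ ∀ s, equivocation x s ≤ C * Real.exp (-(c * s ^ 2)) ∧
      |deriv (equivocation x) s| ≤ C * Real.exp (-(c * s ^ 2)) := by
  obtain ⟨δ, hδ, hmin⟩ := exists_pos_le_norm_sub x hx
  obtain ⟨A, hA⟩ : ∃ A, A = Real.pi⁻¹ * ∫ z : ℂ, Real.exp (-(‖z‖ ^ 2 / 8)) := ⟨_, rfl⟩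
  have hA0 : 0 ≤ A := hA ▸
    mul_nonneg (by positivity) (integral_nonneg fun _ => (Real.exp_pos _).le)
  obtain ⟨B, hB⟩ : ∃ B, B = (M * Real.log 2)⁻¹ *
    ∑ m, ∑ m' ∈ Finset.univ.erase m, (2 + 12 * ‖x m - x m'‖) := ⟨_, rfl⟩
  have hlog : 0 ≤ (M * Real.log 2)⁻¹ :=
    inv_nonneg.2 (mul_nonneg (Nat.cast_nonneg _) (Real.log_nonneg one_le_two))
  have hB0 : 0 ≤ B := hB ▸ mul_nonneg hlog
    (Finset.sum_nonneg fun _ _ => Finset.sum_nonneg fun _ _ => by positivity)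
  have hterm : ∀ (s a : ℝ) (m m' : Fin M), m' ∈ Finset.univ.erase m →
      a ≤ 2 + 12 * ‖x m - x m'‖ → a * Real.exp (-((|s| * ‖x m - x m'‖) ^ 2 / 16)) ≤
        (2 + 12 * ‖x m - x m'‖) * Real.exp (-(δ ^ 2 / 16 * s ^ 2)) := by
    intro s a m m' hm ha
    refine mul_le_mul ha (Real.exp_le_exp.2 ?_) (Real.exp_pos _).le (by positivity)
    rw [mul_pow, sq_abs]
    have := mul_le_mul_of_nonneg_left (pow_le_pow_left₀ hδ.le
      (hmin m m' (Finset.ne_of_mem_erase hm)) 2) (sq_nonneg s)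
    linarith
  have hfin : ∀ (s : ℝ) (F : Fin M → ℝ), (∀ m, F m ≤ (∑ m' ∈ Finset.univ.erase m,
      (2 + 12 * ‖x m - x m'‖) * Real.exp (-(δ ^ 2 / 16 * s ^ 2))) * A) →
      (M * Real.log 2)⁻¹ * ∑ m, F m ≤ (B * A + 1) * Real.exp (-(δ ^ 2 / 16 * s ^ 2)) := by
    intro s F hF
    have := mul_le_mul_of_nonneg_left (Finset.sum_le_sum fun m (_ : m ∈ Finset.univ) => hF m) hlog
    simp_rw [← Finset.sum_mul] at this
    rw [← mul_assoc, ← mul_assoc, ← hB] at this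
    nlinarith [Real.exp_pos (-(δ ^ 2 / 16 * s ^ 2))]
  refine ⟨B * A + 1, δ ^ 2 / 16, by positivity, by positivity, fun s => ⟨?_, ?_⟩⟩
  · refine hfin s _ fun m => (integral_log_likelihoodSum_le x m s).trans ?_
    rw [← hA]
    exact mul_le_mul_of_nonneg_right (Finset.sum_le_sum fun m' hm' =>
      hterm s _ m m' hm' (le_add_of_nonneg_right (by positivity))) hA0
  · rw [(hasDerivAt_equivocation x s).deriv, abs_mul, abs_of_nonneg hlog]
    refine (mul_le_mul_of_nonneg_left (Finset.abs_sum_le_sum_abs _ _) hlog).trans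
      (hfin s _ fun m => (abs_integral_logLikelihoodDeriv_le x m s).trans ?_)
    rw [← hA]
    exact mul_le_mul_of_nonneg_right (Finset.sum_le_sum fun m' hm' =>
      hterm s _ m m' hm' (by linarith)) hA0

lemma equivocation_pos (hM : 2 ≤ M) (s : ℝ) : 0 < equivocation x s := by
  have hM0 : (0 : ℝ) < M := by exact_mod_cast (by omega : 0 < M)
  have hne : Nonempty (Fin M) := ⟨⟨0, by omega⟩⟩
  have hlog2 := Real.log_pos one_lt_two
  refine mul_pos (by positivity) (Finset.sum_pos (fun m _ => ?_) Finset.univ_nonempty)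
  have hpos : ∀ z, 0 < Real.log (likelihoodSum x m s z) := by
    intro z
    refine Real.log_pos ?_
    rw [likelihoodSum_eq]
    refine lt_add_of_pos_right _ (Finset.sum_pos (fun _ _ => pairRatio_pos _ _ _) ?_)
    rw [← Finset.card_pos, Finset.card_erase_of_mem (Finset.mem_univ m), Finset.card_univ,
      Fintype.card_fin]
    omega
  rw [integral_pos_iff_support_of_nonneg (fun z => (hpos z).le)
    (integrable_log_likelihoodSum x m s), Function.support_eq_univ fun z => (hpos z).ne',
    measure_univ]
  exact one_pos

end Constellation

/-! ### Mutual information of the channel -/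

/-- The `CN(0,1)` density as an extended nonnegative function. -/
def gaussDensity (z : ℂ) : ENNReal := ENNReal.ofReal (Real.pi⁻¹ * Real.exp (-‖z‖ ^ 2))

lemma measurable_gaussDensity : Measurable gaussDensity := by
  unfold gaussDensity; fun_prop

section Channel

variable {M : ℕ} (x : Fin M → ℂ) (s : ℝ)

/-- The law on `ℂ` of an equiprobable constellation symbol. -/
def symbolLaw : Measure ℂ := (uniformOn (Set.univ : Set (Fin M))).map x

/-- The density of the output `Y = s X + Z`. -/
def outputDensity (y : ℂ) : ENNReal :=
  ∫⁻ v, gaussDensity (y - s * v) ∂symbolLaw x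

/-- The density of the joint law of `(X, Y)` with respect to the product of its marginals. -/
def channelDensity (p : ℂ × ℂ) : ENNReal :=
  gaussDensity (p.2 - s * p.1) / outputDensity x s p.2

lemma lintegral_uniformOn_univ (F : Fin M → ENNReal) :
    ∫⁻ m, F m ∂uniformOn (Set.univ : Set (Fin M)) = (M : ENNReal)⁻¹ * ∑ m, F m := by
  rw [uniformOn, ProbabilityTheory.cond, lintegral_smul_measure, Measure.restrict_univ,
    lintegral_count, tsum_fintype]
  simp

lemma integral_uniformOn_univ (F : Fin M → ℝ) :
    ∫ m, F m ∂uniformOn (Set.univ : Set (Fin M)) = (M : ℝ)⁻¹ * ∑ m, F m := by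
  rw [uniformOn, ProbabilityTheory.cond, integral_smul_measure, Measure.restrict_univ,
    integral_count]
  simp

lemma lintegral_symbolLaw {F : ℂ → ENNReal} (hF : Measurable F) :
    ∫⁻ v, F v ∂symbolLaw x = (M : ENNReal)⁻¹ * ∑ m, F (x m) := by
  rw [symbolLaw, lintegral_map hF (measurable_of_countable x), lintegral_uniformOn_univ]

lemma measurable_outputDensity : Measurable (outputDensity x s) := by
  have : outputDensity x s = fun y => (M : ENNReal)⁻¹ * ∑ m, gaussDensity (y - s * x m) :=
    funext fun y => lintegral_symbolLaw x (measurable_gaussDensity.comp (by fun_prop))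
  rw [this]
  have := measurable_gaussDensity
  fun_prop

lemma measurable_channelDensity : Measurable (channelDensity x s) :=
  (measurable_gaussDensity.comp (by fun_prop)).div
    ((measurable_outputDensity x s).comp measurable_snd)

lemma outputDensity_eq (m : Fin M) (z : ℂ) :
    outputDensity x s (s * x m + z) =
      ENNReal.ofReal ((M : ℝ)⁻¹ * (Real.pi⁻¹ * Real.exp (-‖z‖ ^ 2) * likelihoodSum x m s z)) := by
  have hM : (0 : ℝ) < M := by exact_mod_cast m.pos
  have hg := measurable_gaussDensity
  rw [outputDensity, lintegral_symbolLaw x (by fun_prop),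
    ENNReal.ofReal_mul (by positivity), ENNReal.ofReal_inv_of_pos hM, ENNReal.ofReal_natCast,
    likelihoodSum, Finset.mul_sum (a := Real.pi⁻¹ * _), ENNReal.ofReal_sum_of_nonneg]
  · congr 1
    refine Finset.sum_congr rfl fun m' _ => ?_
    rw [gaussDensity, pairRatio, mul_assoc, ← Real.exp_add]
    congr 3
    rw [Complex.real_smul]
    ring_nf
  · intro m' _
    have := (pairRatio_pos (x m - x m') s z).le
    positivity

lemma toReal_channelDensity (m : Fin M) (z : ℂ) :
    (channelDensity x s (x m, s * x m + z)).toReal = M / likelihoodSum x m s z := by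
  have hM : (0 : ℝ) < M := by exact_mod_cast m.pos
  have hS := lt_of_lt_of_le one_pos (one_le_likelihoodSum x m s z)
  have := Real.pi_pos
  rw [channelDensity, outputDensity_eq, gaussDensity, ENNReal.toReal_div,
    ENNReal.toReal_ofReal (by positivity), ENNReal.toReal_ofReal (by positivity),
    add_sub_cancel_left]
  field_simp

/-- The joint law of `(X, Y)` with respect to `symbolLaw ⊗ Lebesgue`. -/
lemma map_channel_eq_withDensity :
    ((uniformOn (Set.univ : Set (Fin M))).prod stdComplexGaussian).map
        (fun p => (x p.1, (s : ℂ) * x p.1 + p.2)) =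
      ((symbolLaw x).prod volume).withDensity fun p => gaussDensity (p.2 - s * p.1) := by
  have hx := measurable_of_countable x
  have hg := measurable_gaussDensity
  refine Measure.ext_of_lintegral _ fun F hF => ?_
  rw [lintegral_map hF (by fun_prop), lintegral_prod _ (by fun_prop),
    lintegral_withDensity_eq_lintegral_mul _ (by fun_prop) hF,
    lintegral_prod _ (by fun_prop), symbolLaw, lintegral_map (by fun_prop) hx]
  refine lintegral_congr fun m => ?_
  rw [show stdComplexGaussian = volume.withDensity gaussDensity from rfl,
    lintegral_withDensity_eq_lintegral_mul _ hg (by fun_prop),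
    ← lintegral_sub_right_eq_self _ ((s : ℂ) * x m)]
  refine lintegral_congr fun y => ?_
  simp [gaussDensity]

lemma map_channel_fst :
    (((symbolLaw x).prod volume).withDensity fun p => gaussDensity (p.2 - s * p.1)).fst =
      symbolLaw x := by
  rw [← map_channel_eq_withDensity, Measure.fst, Measure.map_map measurable_fst
    (by have := measurable_of_countable x; fun_prop)]
  have : (Prod.fst ∘ fun p : Fin M × ℂ => (x p.1, (s : ℂ) * x p.1 + p.2)) = x ∘ Prod.fst := rfl
  rw [this, ← Measure.map_map (measurable_of_countable x) measurable_fst, Measure.map_fst_prod,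
    measure_univ, one_smul, symbolLaw]

variable [NeZero M]

instance isProbabilityMeasure_symbolLaw : IsProbabilityMeasure (symbolLaw x) :=
  have : IsProbabilityMeasure (uniformOn (Set.univ : Set (Fin M))) :=
    isProbabilityMeasure_uniformOn Set.finite_univ Set.univ_nonempty
  Measure.isProbabilityMeasure_map (measurable_of_countable x).aemeasurable

lemma map_channel_snd :
    (((symbolLaw x).prod volume).withDensity fun p => gaussDensity (p.2 - s * p.1)).snd =
      volume.withDensity (outputDensity x s) := by
  have hg := measurable_gaussDensity
  refine Measure.ext_of_lintegral _ fun F hF => ?_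
  rw [Measure.snd, lintegral_map hF measurable_snd,
    lintegral_withDensity_eq_lintegral_mul _ (by fun_prop) (by fun_prop),
    lintegral_prod_symm _ (by fun_prop),
    lintegral_withDensity_eq_lintegral_mul _ (measurable_outputDensity x s) hF]
  refine lintegral_congr fun y => ?_
  simp only [Pi.mul_apply]
  rw [lintegral_mul_const _ (by fun_prop), outputDensity]

end Channel

/-- The mutual information is the input entropy `log₂ M` minus the equivocation. -/
theorem constellationMI_eq {M : ℕ} [NeZero M] (x : Fin M → ℂ) (γ : ℝ) :
    constellationMI x γ = Real.logb 2 M - equivocation x (√γ) := by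
  have hM : (0 : ℝ) < M := by exact_mod_cast NeZero.pos M
  have hx := measurable_of_countable x
  have hg := measurable_gaussDensity
  have hq := measurable_outputDensity x (√γ)
  have hρ := measurable_channelDensity x (√γ)
  have : IsProbabilityMeasure (uniformOn (Set.univ : Set (Fin M))) :=
    isProbabilityMeasure_uniformOn Set.finite_univ Set.univ_nonempty
  have hmap : Measurable fun p : Fin M × ℂ => (x p.1, (√γ : ℂ) * x p.1 + p.2) := by fun_prop
  have hJ : IsProbabilityMeasure (channelLaw x γ) :=
    Measure.isProbabilityMeasure_map hmap.aemeasurable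
  set P := (channelLaw x γ).fst.prod (channelLaw x γ).snd with hP
  have hPJ : channelLaw x γ = P.withDensity (channelDensity x (√γ)) := by
    have h1 : channelLaw x γ = ((symbolLaw x).prod volume).withDensity
        fun p => gaussDensity (p.2 - (√γ : ℝ) * p.1) := map_channel_eq_withDensity x (√γ)
    have h0 : ∀ y, outputDensity x (√γ) y ≠ 0 ∧ outputDensity x (√γ) y ≠ ⊤ := by
      intro y
      have m : Fin M := ⟨0, NeZero.pos M⟩
      have := outputDensity_eq x (√γ) m (y - (√γ : ℝ) * x m)
      rw [add_sub_cancel] at this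
      have hS := lt_of_lt_of_le one_pos (one_le_likelihoodSum x m (√γ) (y - (√γ : ℝ) * x m))
      rw [this]
      exact ⟨(ENNReal.ofReal_pos.2 (by positivity)).ne', ENNReal.ofReal_ne_top⟩
    rw [hP, h1, map_channel_fst, map_channel_snd, prod_withDensity_right hq,
      ← withDensity_mul _ (by fun_prop) hρ]
    congr 1
    funext p
    simp only [Pi.mul_apply, channelDensity]
    rw [ENNReal.mul_div_cancel (h0 _).1 (h0 _).2]
  have hac : channelLaw x γ ≪ P := hPJ ▸ withDensity_absolutelyContinuous _ _
  have hllr : llr (channelLaw x γ) P =ᵐ[channelLaw x γ]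
      fun p => Real.log (channelDensity x (√γ) p).toReal := by
    have h := hac.ae_le (Measure.rnDeriv_withDensity P hρ)
    rw [← hPJ] at h
    filter_upwards [h] with p hp
    rw [llr, hp]
  have hint : Integrable (fun p : Fin M × ℂ => Real.log (likelihoodSum x p.1 (√γ) p.2))
      ((uniformOn (Set.univ : Set (Fin M))).prod stdComplexGaussian) := by
    have hmeas : Measurable fun p : Fin M × ℂ => Real.log (likelihoodSum x p.1 (√γ) p.2) :=
      measurable_from_prod_countable_right fun m =>
        (continuous_log_likelihoodSum x m (√γ)).measurable
    rw [integrable_prod_iff hmeas.aestronglyMeasurable]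
    exact ⟨ae_of_all _ fun m => integrable_log_likelihoodSum x m _, .of_finite⟩
  have hlog : ∀ p : Fin M × ℂ,
      Real.log (channelDensity x (√γ) (x p.1, (√γ : ℂ) * x p.1 + p.2)).toReal =
        Real.log M - Real.log (likelihoodSum x p.1 (√γ) p.2) := by
    intro p
    have hS := lt_of_lt_of_le one_pos (one_le_likelihoodSum x p.1 (√γ) p.2)
    rw [toReal_channelDensity, Real.log_div hM.ne' hS.ne']
  rw [constellationMI, mutualInfoBits, ← hP,
    InformationTheory.toReal_klDiv_of_measure_eq hac (by simp [hP]), integral_congr_ae hllr,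
    channelLaw, integral_map hmap.aemeasurable hρ.ennreal_toReal.log.aestronglyMeasurable]
  simp_rw [hlog]
  rw [integral_sub (integrable_const _) hint, integral_prod _ hint, integral_uniformOn_univ,
    integral_const, probReal_univ, one_smul, sub_div, Real.logb, equivocation]
  have := Real.log_pos one_lt_two
  field_simp

/-! ### Mellin transform of the MMSE -/

section Mellin

lemma mellinIntegrand_natCast_add_one (f : ℝ → ℝ) (n : ℕ) :
    mellinIntegrand f ((n : ℝ) + 1) = fun γ => γ ^ n * f γ := by
  funext γ
  rw [mellinIntegrand, add_sub_cancel_right, Real.rpow_natCast]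

variable {M : ℕ} (x : Fin M → ℂ)

lemma hasDerivAt_equivocation_sqrt {γ : ℝ} (hγ : 0 < γ) :
    HasDerivAt (fun γ => equivocation x (√γ)) (deriv (equivocation x) (√γ) * (1 / (2 * √γ))) γ :=
  ((hasDerivAt_equivocation x (√γ)).differentiableAt.hasDerivAt).comp γ
    (Real.hasDerivAt_sqrt hγ.ne')

lemma equivocation_nonneg (s : ℝ) : 0 ≤ equivocation x s :=
  mul_nonneg (inv_nonneg.2 (mul_nonneg (Nat.cast_nonneg _) (Real.log_nonneg one_le_two)))
    (Finset.sum_nonneg fun m _ => integral_nonneg fun z => log_likelihoodSum_nonneg x m s z)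

lemma integrableOn_pow_mul_equivocation (hx : Function.Injective x) (n : ℕ) :
    IntegrableOn (fun γ => γ ^ n * equivocation x (√γ)) (Set.Ioi 0) := by
  obtain ⟨C, c, hC, hc, hb⟩ := exists_equivocation_le x hx
  have hn : (-1 : ℝ) < n := by
    have : (0 : ℝ) ≤ n := n.cast_nonneg
    linarith
  have hm := (continuous_equivocation x).measurable
  refine ((integrableOn_rpow_mul_exp_neg_mul_rpow hn one_pos hc).const_mul C).mono'
    (by fun_prop) ?_
  refine (ae_restrict_iff' measurableSet_Ioi).2 (ae_of_all _ fun γ hγ => ?_)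
  have hγ : 0 < γ := hγ
  have h1 := (hb (√γ)).1
  have h0 := equivocation_nonneg x (√γ)
  rw [Real.sq_sqrt hγ.le] at h1
  rw [Real.norm_of_nonneg (by positivity), Real.rpow_natCast, Real.rpow_one, neg_mul]
  calc γ ^ n * equivocation x √γ ≤ γ ^ n * (C * Real.exp (-(c * γ))) := by gcongr
    _ = _ := by ring

variable [NeZero M]

lemma hasDerivAt_constellationMI {γ : ℝ} (hγ : 0 < γ) :
    HasDerivAt (constellationMI x) (-(deriv (equivocation x) (√γ) * (1 / (2 * √γ)))) γ := by
  rw [show constellationMI x = fun γ => Real.logb 2 M - equivocation x (√γ) from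
    funext (constellationMI_eq x)]
  exact (hasDerivAt_equivocation_sqrt x hγ).const_sub _

lemma hasDerivAt_equivocation_sqrt_mmse {γ : ℝ} (hγ : 0 < γ) :
    HasDerivAt (fun γ => equivocation x (√γ)) (-mmse x γ) γ := by
  rw [mmse, (hasDerivAt_constellationMI x hγ).deriv, neg_neg]
  exact hasDerivAt_equivocation_sqrt x hγ

lemma integrableOn_pow_mul_mmse (hx : Function.Injective x) (n : ℕ) :
    IntegrableOn (fun γ => γ ^ n * mmse x γ) (Set.Ioi 0) := by
  obtain ⟨C, c, hC, hc, hb⟩ := exists_equivocation_le x hx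
  have hn : (-1 : ℝ) < n - 1 / 2 := by
    have : (0 : ℝ) ≤ n := n.cast_nonneg
    linarith
  refine ((integrableOn_rpow_mul_exp_neg_mul_rpow hn one_pos hc).const_mul (C / 2)).mono'
    ((measurable_id.pow_const n).mul (measurable_deriv _)).aestronglyMeasurable ?_
  refine (ae_restrict_iff' measurableSet_Ioi).2 (ae_of_all _ fun γ hγ => ?_)
  have hγ : 0 < γ := hγ
  have h1 := (hb (√γ)).2
  rw [Real.sq_sqrt hγ.le] at h1
  rw [mmse, (hasDerivAt_constellationMI x hγ).deriv, norm_mul, norm_neg, norm_mul,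
    Real.norm_of_nonneg (by positivity : (0 : ℝ) ≤ γ ^ n), Real.norm_eq_abs,
    Real.norm_of_nonneg (by positivity : (0 : ℝ) ≤ 1 / (2 * √γ)), Real.rpow_sub hγ,
    Real.rpow_natCast, ← Real.sqrt_eq_rpow, Real.rpow_one, neg_mul]
  calc γ ^ n * (|deriv (equivocation x) √γ| * (1 / (2 * √γ)))
      ≤ γ ^ n * (C * Real.exp (-(c * γ)) * (1 / (2 * √γ))) := by gcongr
    _ = _ := by field_simp

/-- Integration by parts turns the Mellin transform of the MMSE into a moment of the
equivocation. -/
lemma realMellin_mmse_eq (hx : Function.Injective x) (n : ℕ) :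
    realMellin (mmse x) (((n + 1 : ℕ) : ℝ) + 1) =
      (n + 1) * ∫ γ in Set.Ioi 0, γ ^ n * equivocation x (√γ) := by
  obtain ⟨C, c, hC, hc, hb⟩ := exists_equivocation_le x hx
  have hcont : Continuous fun γ => γ ^ (n + 1) * equivocation x (√γ) := by
    have := continuous_equivocation x
    fun_prop
  have h0 : Tendsto ((fun γ => γ ^ (n + 1)) * fun γ => equivocation x (√γ)) (𝓝[>] 0) (𝓝 0) := by
    have := (hcont.tendsto 0).mono_left (nhdsWithin_le_nhds (s := Set.Ioi 0))
    rwa [zero_pow (Nat.succ_ne_zero n), zero_mul] at this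
  have hinf : Tendsto ((fun γ => γ ^ (n + 1)) * fun γ => equivocation x (√γ)) atTop (𝓝 0) := by
    have h1 := (tendsto_rpow_mul_exp_neg_mul_atTop_nhds_zero ((n + 1 : ℕ) : ℝ) c hc).const_mul C
    rw [mul_zero] at h1
    refine squeeze_zero' ?_ ?_ h1
    · filter_upwards [eventually_ge_atTop 0] with γ hγ
      exact mul_nonneg (pow_nonneg hγ _) (equivocation_nonneg x _)
    · filter_upwards [eventually_ge_atTop 0] with γ hγ
      have h1 := (hb (√γ)).1
      rw [Real.sq_sqrt hγ] at h1
      rw [Real.rpow_natCast, Pi.mul_apply, neg_mul]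
      calc γ ^ (n + 1) * equivocation x √γ ≤ γ ^ (n + 1) * (C * Real.exp (-(c * γ))) := by gcongr
        _ = _ := by ring
  have hparts := integral_Ioi_mul_deriv_eq_deriv_mul (a := 0)
    (u := fun γ => γ ^ (n + 1)) (v := fun γ => equivocation x (√γ))
    (u' := fun γ => (n + 1) * γ ^ n) (v' := fun γ => -mmse x γ)
    (fun γ _ => by simpa using hasDerivAt_pow (n + 1) γ)
    (fun γ hγ => hasDerivAt_equivocation_sqrt_mmse x hγ)
    ((integrableOn_pow_mul_mmse x hx (n + 1)).neg.congr
      (ae_of_all _ fun γ => by simp))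
    (((integrableOn_pow_mul_equivocation x hx n).const_mul ((n : ℝ) + 1)).congr
      (ae_of_all _ fun γ => by simp [mul_assoc])) h0 hinf
  rw [realMellin, mellinIntegrand_natCast_add_one]
  simp only [mul_neg, integral_neg, mul_assoc, integral_const_mul] at hparts
  linarith

lemma realMellin_mmse_pos (hM : 2 ≤ M) (hx : Function.Injective x) (n : ℕ) :
    0 < realMellin (mmse x) (((n + 1 : ℕ) : ℝ) + 1) := by
  rw [realMellin_mmse_eq x hx]
  refine mul_pos (by positivity) ?_
  rw [setIntegral_pos_iff_support_of_nonneg_ae ?_ (integrableOn_pow_mul_equivocation x hx n)]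
  · have hsub : Set.Ioi (0 : ℝ) ⊆
        Function.support (fun γ => γ ^ n * equivocation x (√γ)) ∩ Set.Ioi 0 := fun γ hγ =>
      ⟨(mul_pos (pow_pos hγ n) (equivocation_pos x hM _)).ne', hγ⟩
    exact lt_of_lt_of_le (by simp) (measure_mono hsub)
  · exact (ae_restrict_iff' measurableSet_Ioi).2 (ae_of_all _ fun γ hγ =>
      mul_nonneg (pow_nonneg (le_of_lt hγ) n) (equivocation_nonneg x _))

/-- The weight `tⁿ / n!` is the density of the coordinate sum on the positive orthant of `ℝⁿ⁺¹`, so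
this moment is the limit of the mean equivocation in the rescaled SNRs. -/
lemma lintegral_pow_div_factorial_mul_equivocation (hx : Function.Injective x) (n : ℕ) :
    ∫⁻ t in Set.Ioi 0, ENNReal.ofReal (t ^ n / n.factorial) *
        ENNReal.ofReal (equivocation x (√t)) =
      ENNReal.ofReal
        (realMellin (mmse x) (((n + 1 : ℕ) : ℝ) + 1) / (n + 1).factorial) := by
  have hval : realMellin (mmse x) (((n + 1 : ℕ) : ℝ) + 1) / (n + 1).factorial =
      ∫ t in Set.Ioi 0, (n.factorial : ℝ)⁻¹ * (t ^ n * equivocation x (√t)) := by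
    rw [realMellin_mmse_eq x hx, integral_const_mul, Nat.factorial_succ]
    have : (n.factorial : ℝ) ≠ 0 := by positivity
    push_cast
    field_simp
  rw [hval, ofReal_integral_eq_lintegral_ofReal
    ((integrableOn_pow_mul_equivocation x hx n).const_mul _)]
  · refine setLIntegral_congr_fun measurableSet_Ioi fun t ht => ?_
    have ht : 0 < t := ht
    rw [← ENNReal.ofReal_mul (by positivity)]
    congr 1
    ring
  · exact (ae_restrict_iff' measurableSet_Ioi).2 (ae_of_all _ fun γ hγ =>
      mul_nonneg (by positivity) (mul_nonneg (pow_nonneg (le_of_lt hγ) n)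
        (equivocation_nonneg x _)))

end Mellin

/-! ### Sums of independent exponentials -/

section SumOfExponentials

/-- Fubini's theorem for a finite product measure, with the first coordinate split off. -/
lemma lintegral_pi_fin_succ {n : ℕ} (ν : Fin (n + 1) → Measure ℝ) [∀ i, SigmaFinite (ν i)]
    {F : (Fin (n + 1) → ℝ) → ENNReal} (hF : Measurable F) :
    ∫⁻ u, F u ∂Measure.pi ν =
      ∫⁻ a, ∫⁻ v, F (Fin.cons a v) ∂Measure.pi (fun j => ν j.succ) ∂ν 0 := by
  have hp := (measurePreserving_piFinSuccAbove ν 0).symm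
  have hm : Measurable fun p : ℝ × (Fin n → ℝ) =>
      F ((MeasurableEquiv.piFinSuccAbove (fun _ => ℝ) 0).symm p) :=
    hF.comp (MeasurableEquiv.measurable _)
  rw [← hp.lintegral_comp hF, lintegral_prod _ hm.aemeasurable]
  simp [MeasurableEquiv.piFinSuccAbove_symm_apply, Fin.insertNthEquiv]

lemma measurable_fin_cons (n : ℕ) :
    Measurable fun p : ℝ × (Fin n → ℝ) => (Fin.cons p.1 p.2 : Fin (n + 1) → ℝ) := by
  refine measurable_pi_lambda _ fun i => ?_
  refine Fin.cases ?_ (fun j => ?_) i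
  · simpa using measurable_fst
  · simp only [Fin.cons_succ]
    fun_prop

/-- A product of measures with densities has the product density. -/
lemma lintegral_pi_withDensity {n : ℕ} (ν : Fin n → Measure ℝ) [∀ i, SigmaFinite (ν i)]
    (f : Fin n → ℝ → ENNReal) (hf : ∀ i, Measurable (f i))
    [∀ i, SigmaFinite ((ν i).withDensity (f i))]
    {F : (Fin n → ℝ) → ENNReal} (hF : Measurable F) :
    ∫⁻ u, F u ∂Measure.pi (fun i => (ν i).withDensity (f i)) =
      ∫⁻ u, (∏ i, f i (u i)) * F u ∂Measure.pi ν := by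
  induction n with
  | zero =>
    rw [Measure.pi_of_empty, Measure.pi_of_empty]
    simp
  | succ n ih =>
    rw [lintegral_pi_fin_succ _ hF, lintegral_pi_fin_succ _ (by fun_prop)]
    have hinner : ∀ a, ∫⁻ v, F (Fin.cons a v) ∂Measure.pi
        (fun j : Fin n => (ν j.succ).withDensity (f j.succ)) =
        ∫⁻ v, (∏ j : Fin n, f j.succ (v j)) * F (Fin.cons a v)
          ∂Measure.pi (fun j : Fin n => ν j.succ) := fun a =>
      ih (fun j => ν j.succ) (fun j => f j.succ) (fun j => hf _) 
        (hF.comp ((measurable_fin_cons n).comp measurable_prodMk_left))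
    simp_rw [hinner]
    have hF2 := hF.comp (measurable_fin_cons n)
    have hm : Measurable fun p : ℝ × (Fin n → ℝ) =>
        (∏ j : Fin n, f j.succ (p.2 j)) * F (Fin.cons p.1 p.2) :=
      Measurable.mul (by fun_prop) hF2
    rw [lintegral_withDensity_eq_lintegral_mul _ (hf 0) hm.lintegral_prod_right']
    refine lintegral_congr fun a => ?_
    have hma := hm.comp (measurable_prodMk_left (x := a))
    simp only [Function.comp_def] at hma
    rw [Pi.mul_apply, ← lintegral_const_mul _ hma]
    refine lintegral_congr fun v => ?_
    rw [Fin.prod_univ_succ]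
    simp [mul_assoc]

/-- Integrating a function of the coordinate sum over the positive orthant of `ℝⁿ⁺¹`. -/
lemma lintegral_pi_Ioi_comp_sum (n : ℕ) {F : ℝ → ENNReal} (hF : Measurable F) :
    ∫⁻ u, F (∑ i, u i) ∂Measure.pi (fun _ : Fin (n + 1) => volume.restrict (Set.Ioi 0)) =
      ∫⁻ t in Set.Ioi 0, ENNReal.ofReal (t ^ n / n.factorial) * F t := by
  induction n generalizing F with
  | zero =>
    rw [lintegral_pi_fin_succ _ (by fun_prop)]
    simp
  | succ n ih =>
    rw [lintegral_pi_fin_succ _ (by fun_prop)]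
    simp only [Fin.sum_univ_succ (n := n + 1), Fin.cons_zero, Fin.cons_succ]
    -- `r = a + t` is the whole sum; the weight `(r - a)ⁿ / n!` is then integrated over `0 < a < r`
    have h1 : ∀ a ∈ Set.Ioi (0 : ℝ),
        ∫⁻ v, F (a + ∑ j, v j) ∂Measure.pi
          (fun _ : Fin (n + 1) => volume.restrict (Set.Ioi (0 : ℝ))) =
        ∫⁻ r in Set.Ioi 0, (Set.Iio r).indicator
          (fun a => ENNReal.ofReal ((r - a) ^ n / n.factorial)) a * F r := by
      intro a ha
      have ha : 0 < a := ha
      rw [ih (F := fun t => F (a + t)) (by fun_prop), ← lintegral_indicator measurableSet_Ioi,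
        ← lintegral_indicator measurableSet_Ioi, ← lintegral_sub_right_eq_self _ a]
      refine lintegral_congr fun r => ?_
      by_cases hr : a < r
      · rw [Set.indicator_of_mem (by simpa using hr),
          Set.indicator_of_mem (Set.mem_Ioi.2 (ha.trans hr)),
          Set.indicator_of_mem (Set.mem_Iio.2 hr), add_sub_cancel]
      · rw [Set.indicator_of_notMem (by simpa using hr)]
        by_cases hr0 : 0 < r
        · rw [Set.indicator_of_mem (Set.mem_Ioi.2 hr0), Set.indicator_of_notMem (by simpa using hr),
            zero_mul]
        · rw [Set.indicator_of_notMem (by simpa using hr0)]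
    have hmeas : Measurable (Function.uncurry fun a r : ℝ => (Set.Iio r).indicator
        (fun a => ENNReal.ofReal ((r - a) ^ n / n.factorial)) a * F r) := by
      have e : (Function.uncurry fun a r : ℝ => (Set.Iio r).indicator
        (fun a => ENNReal.ofReal ((r - a) ^ n / n.factorial)) a * F r) =
        fun p : ℝ × ℝ => {p : ℝ × ℝ | p.1 < p.2}.indicator
          (fun p => ENNReal.ofReal ((p.2 - p.1) ^ n / n.factorial)) p * F p.2 := by
        funext p; rfl
      rw [e]
      exact (Measurable.indicator (by fun_prop)
        (measurableSet_lt measurable_fst measurable_snd)).mul (hF.comp measurable_snd)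
    rw [setLIntegral_congr_fun measurableSet_Ioi h1, lintegral_lintegral_swap hmeas.aemeasurable]
    refine setLIntegral_congr_fun measurableSet_Ioi fun r hr => ?_
    have hr : 0 < r := hr
    rw [lintegral_mul_const _ (Measurable.indicator (by fun_prop) measurableSet_Iio),
      lintegral_indicator measurableSet_Iio, Measure.restrict_restrict measurableSet_Iio,
      Set.Iio_inter_Ioi]
    congr 1
    rw [← ofReal_integral_eq_lintegral_ofReal]
    · rw [← integral_Ioc_eq_integral_Ioo, ← intervalIntegral.integral_of_le hr.le,
        intervalIntegral.integral_comp_sub_left (fun t => t ^ n / (n.factorial : ℝ)) r,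
        intervalIntegral.integral_div, integral_pow, Nat.factorial_succ]
      congr 1
      push_cast
      have : (n.factorial : ℝ) ≠ 0 := by positivity
      field_simp
      simp
    · exact ((Continuous.integrableOn_Icc (by fun_prop)).mono_set Set.Ioo_subset_Icc_self)
    · refine (ae_restrict_iff' measurableSet_Ioo).2 (ae_of_all _ fun a ha => ?_)
      have : 0 ≤ r - a := by linarith [ha.2]
      simp only [Pi.zero_apply]
      positivity

/-- For independent exponentials of means `s b_k`, the expectation of an integrable function of
their sum decays like `s^{-(n+1)}`: after scaling out the constant prefactor, the joint density
tends to `1` on the whole positive orthant. -/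
lemma tendsto_lintegral_pi_expMeasure {n : ℕ} {b : Fin (n + 1) → ℝ} (hb : ∀ k, 0 < b k)
    {F : ℝ → ENNReal} (hF : Measurable F)
    (hfin : ∫⁻ t in Set.Ioi 0, ENNReal.ofReal (t ^ n / n.factorial) * F t ≠ ⊤) :
    Tendsto (fun s : ℝ => ENNReal.ofReal (s ^ (n + 1) * ∏ k, b k) *
        ∫⁻ u, F (∑ k, u k) ∂Measure.pi (fun k => expMeasure (1 / (s * b k)))) atTop
      (𝓝 (∫⁻ t in Set.Ioi 0, ENNReal.ofReal (t ^ n / n.factorial) * F t)) := by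
  set ν : Measure (Fin (n + 1) → ℝ) :=
    Measure.pi (fun _ : Fin (n + 1) => volume.restrict (Set.Ioi 0)) with hν
  have hFs : Measurable fun u : Fin (n + 1) → ℝ => F (∑ k, u k) := by fun_prop
  have hscale : ∀ s : ℝ, 0 < s → ENNReal.ofReal (s ^ (n + 1) * ∏ k, b k) *
      ∫⁻ u, F (∑ k, u k) ∂Measure.pi (fun k => expMeasure (1 / (s * b k))) =
      ∫⁻ u, ENNReal.ofReal (Real.exp (-((∑ k, u k / b k) / s))) * F (∑ k, u k) ∂ν := by
    intro s hs
    have hsig : ∀ k, SigmaFinite ((volume.restrict (Set.Ioi (0 : ℝ))).withDensity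
        fun u => ENNReal.ofReal (1 / (s * b k) * Real.exp (-(1 / (s * b k) * u)))) := by
      intro k
      rw [← expMeasure_eq_withDensity_restrict]
      have := isProbabilityMeasure_expMeasure (r := 1 / (s * b k))
        (one_div_pos.2 (mul_pos hs (hb k)))
      infer_instance
    simp only [expMeasure_eq_withDensity_restrict]
    rw [lintegral_pi_withDensity (fun _ => volume.restrict (Set.Ioi (0 : ℝ))) _
      (fun k => by fun_prop) hFs, ← lintegral_const_mul _ (by fun_prop)]
    refine lintegral_congr fun u => ?_
    have hpb : 0 < ∏ k, b k := Finset.prod_pos fun k _ => hb k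
    rw [← ENNReal.ofReal_prod_of_nonneg (fun k _ => by have := hb k; positivity), ← mul_assoc,
      ← ENNReal.ofReal_mul (by positivity), Finset.prod_mul_distrib, ← Real.exp_sum,
      Finset.prod_div_distrib, Finset.prod_mul_distrib]
    simp only [Finset.prod_const, Finset.card_univ, Fintype.card_fin, one_pow]
    congr 2
    rw [← mul_assoc, mul_one_div_cancel (by positivity), one_mul, Finset.sum_neg_distrib,
      Finset.sum_div]
    congr 2
    refine Finset.sum_congr rfl fun k _ => ?_
    have := (hb k).ne'
    field_simp
  rw [← lintegral_pi_Ioi_comp_sum n hF] at hfin ⊢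
  have hlim : Tendsto (fun s : ℝ => ∫⁻ u, ENNReal.ofReal (Real.exp (-((∑ k, u k / b k) / s))) *
      F (∑ k, u k) ∂ν) atTop (𝓝 (∫⁻ u, F (∑ k, u k) ∂ν)) := by
    refine tendsto_lintegral_filter_of_dominated_convergence (fun u => F (∑ k, u k))
      (Eventually.of_forall fun s => by fun_prop) ?_ hfin (ae_of_all _ fun u => ?_)
    · filter_upwards [eventually_gt_atTop 0] with s hs
      have hae : ∀ᵐ u ∂ν, ∀ k, 0 < u k := by
        rw [hν, ← Measure.restrict_pi_pi]
        refine (ae_restrict_iff' (MeasurableSet.univ_pi fun _ => measurableSet_Ioi)).2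
          (ae_of_all _ fun u hu k => hu k (Set.mem_univ k))
      filter_upwards [hae] with u hu
      refine mul_le_of_le_one_left' ?_
      rw [ENNReal.ofReal_le_one, Real.exp_le_one_iff, neg_nonpos]
      exact div_nonneg (Finset.sum_nonneg fun k _ => (div_pos (hu k) (hb k)).le) hs.le
    · have h1 : Tendsto (fun s : ℝ => ENNReal.ofReal (Real.exp (-((∑ k, u k / b k) / s)))) atTop
          (𝓝 1) := by
        have h2 : Tendsto (fun s : ℝ => (∑ k, u k / b k) / s) atTop (𝓝 0) :=
          tendsto_const_nhds.div_atTop tendsto_id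
        have h3 := ENNReal.tendsto_ofReal ((Real.continuous_exp.tendsto _).comp h2.neg)
        simpa using h3
      simpa using ENNReal.Tendsto.mul_const h1 (Or.inl one_ne_zero)
  refine hlim.congr' ?_
  filter_upwards [eventually_gt_atTop 0] with s hs
  exact (hscale s hs).symm

end SumOfExponentials

/-! ### High-SNR limit of the average multicast rate -/

/-- The deviation of the cooperative rate from `log₂ M` is the mean equivocation, an integral
against a product of exponential laws. -/
lemma logb_sub_coopAMR_eq {Ω : Type*} [MeasurableSpace Ω] {μ : Measure Ω} [IsProbabilityMeasure μ]
    {M K N : ℕ} [NeZero M] (x : Fin M → ℂ) (hx : Function.Injective x) {f : Fin N → ℂ}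
    {R : Fin K → Matrix (Fin N) (Fin N) ℂ} (hgain : ∀ k, 0 < beamGain f (R k))
    {h : Fin K → Ω → Fin N → ℂ} (h_gauss : ∀ k, IsComplexGaussian (h k) (R k) μ)
    (h_indep : iIndepFun h μ) {s : ℝ} (hs : 0 < s) :
    Real.logb 2 M - coopAMR μ x f h s =
      (∫⁻ u, ENNReal.ofReal (equivocation x (√(∑ k, u k)))
        ∂Measure.pi (fun k => expMeasure (1 / (s * beamGain f (R k))))).toReal := by
  have hlaw := fun k => (h_gauss k).hasLaw_receivedSNR (hgain k) hs
  have hind : iIndepFun (fun k ω => receivedSNR f (h k ω) s) μ :=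
    h_indep.comp _ fun _ => measurable_receivedSNR f s
  have hmap := (iIndepFun_iff_map_fun_eq_pi_map fun k => (hlaw k).aemeasurable).1 hind
  simp only [(hlaw _).map_eq] at hmap
  have hae : AEMeasurable (fun ω k => receivedSNR f (h k ω) s) μ :=
    aemeasurable_pi_lambda _ fun k => (hlaw k).aemeasurable
  have hcont : Continuous fun u : Fin K → ℝ => equivocation x (√(∑ k, u k)) := by
    have := continuous_equivocation x
    fun_prop
  have hmeas : AEStronglyMeasurable (fun ω => equivocation x (√(mrcSNR f (fun k => h k ω) s))) μ :=
    (hcont.measurable.comp_aemeasurable hae).aestronglyMeasurable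
  have hint : Integrable (fun ω => equivocation x (√(mrcSNR f (fun k => h k ω) s))) μ := by
    obtain ⟨C, c, hC, hc, hb⟩ := exists_equivocation_le x hx
    refine (integrable_const C).mono' hmeas (ae_of_all _ fun ω => ?_)
    rw [Real.norm_of_nonneg (equivocation_nonneg x _)]
    refine ((hb _).1).trans (mul_le_of_le_one_right hC.le (Real.exp_le_one_iff.2 ?_))
    exact neg_nonpos.2 (mul_nonneg hc.le (sq_nonneg _))
  rw [coopAMR]
  simp_rw [constellationMI_eq]
  rw [integral_sub (integrable_const _) hint, integral_const, probReal_univ, one_smul,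
    sub_sub_cancel, integral_eq_lintegral_of_nonneg_ae
      (ae_of_all _ fun ω => equivocation_nonneg x _) hmeas, ← hmap,
    lintegral_map' hcont.measurable.ennreal_ofReal.aemeasurable hae]
  rfl

/-- The leading coefficient of the deviation from `log₂ M`, at order `s^{-(n+1)}`. -/
lemma tendsto_pow_mul_logb_sub_coopAMR {Ω : Type*} [MeasurableSpace Ω] {μ : Measure Ω}
    [IsProbabilityMeasure μ] {M n N : ℕ} (hM : 2 ≤ M) (x : Fin M → ℂ)
    (hx : Function.Injective x) {f : Fin N → ℂ}
    {R : Fin (n + 1) → Matrix (Fin N) (Fin N) ℂ} (hgain : ∀ k, 0 < beamGain f (R k))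
    {h : Fin (n + 1) → Ω → Fin N → ℂ} (h_gauss : ∀ k, IsComplexGaussian (h k) (R k) μ)
    (h_indep : iIndepFun h μ) :
    Tendsto (fun s : ℝ => s ^ (n + 1) * (∏ k, beamGain f (R k)) *
        (Real.logb 2 M - coopAMR μ x f h s)) atTop
      (𝓝 (realMellin (mmse x) (((n + 1 : ℕ) : ℝ) + 1) / (n + 1).factorial)) := by
  have : NeZero M := ⟨by omega⟩
  have hpos := realMellin_mmse_pos x hM hx n
  have hF : Measurable fun t : ℝ => ENNReal.ofReal (equivocation x (√t)) := by
    have := (continuous_equivocation x).measurable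
    fun_prop
  have hval := lintegral_pow_div_factorial_mul_equivocation x hx n
  have hlim := tendsto_lintegral_pi_expMeasure hgain hF (by rw [hval]; exact ENNReal.ofReal_ne_top)
  rw [hval] at hlim
  have hreal := (ENNReal.tendsto_toReal ENNReal.ofReal_ne_top).comp hlim
  rw [ENNReal.toReal_ofReal (by positivity)] at hreal
  refine hreal.congr' ?_
  filter_upwards [eventually_gt_atTop 0] with s hs
  have hprod : 0 < ∏ k, beamGain f (R k) := Finset.prod_pos fun k _ => hgain k
  rw [Function.comp_apply, ENNReal.toReal_mul, ENNReal.toReal_ofReal (by positivity),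
    logb_sub_coopAMR_eq x hx hgain h_gauss h_indep hs]

end AnalogMulticast

end

theorem mainTheorem2
    {Ω : Type*} [MeasurableSpace Ω] (μ : Measure Ω) [IsProbabilityMeasure μ]
    (M K N : ℕ) (hK : 0 < K)
    -- unit-energy, zero-mean constellation of `M` distinct points
    (x : Fin M → ℂ) (hx_inj : Function.Injective x)
    (hx_mean : (∑ m, x m) / (M : ℂ) = 0)
    (hx_energy : (∑ m, ‖x m‖ ^ 2) / (M : ℝ) = 1)
    -- analog beamformer, correlation matrices and independent correlated Rayleigh channels
    (θ : Fin N → ℝ)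
    (R : Fin K → Matrix (Fin N) (Fin N) ℂ) (hR : ∀ k, (R k).PosSemidef)
    (hgain : ∀ k, 0 < AnalogMulticast.beamGain (AnalogMulticast.beamformer θ) (R k))
    (h : Fin K → Ω → Fin N → ℂ)
    (h_gauss : ∀ k, AnalogMulticast.IsComplexGaussian (h k) (R k) μ)
    (h_indep : iIndepFun h μ) :
    -- the branch SNRs are independent exponentials with means `γ̄ fᴴ Rₖ f`
    (∀ γbar : ℝ, 0 < γbar →
      (∀ k, HasLaw
        (fun ω => AnalogMulticast.receivedSNR (AnalogMulticast.beamformer θ) (h k ω) γbar)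
        (expMeasure
          (1 / (γbar * AnalogMulticast.beamGain (AnalogMulticast.beamformer θ) (R k)))) μ) ∧
      iIndepFun (fun k ω =>
        AnalogMulticast.receivedSNR (AnalogMulticast.beamformer θ) (h k ω) γbar) μ) ∧
    -- `MMSE` is a genuine derivative, and its Mellin transform at `K + 1` is finite and positive
    (∀ γ : ℝ, 0 < γ → DifferentiableAt ℝ (AnalogMulticast.constellationMI x) γ) ∧
    IntegrableOn
      (AnalogMulticast.mellinIntegrand (AnalogMulticast.mmse x) ((K : ℝ) + 1)) (Set.Ioi 0) ∧
    0 < AnalogMulticast.realMellin (AnalogMulticast.mmse x) ((K : ℝ) + 1) ∧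
    -- the array gain is positive, and the AMR is `log₂ M - (d γ̄)^(-K)` at high SNR
    0 < AnalogMulticast.coopArrayGain x (AnalogMulticast.beamformer θ) R ∧
    AnalogMulticast.HasHighSNRForm
      (AnalogMulticast.coopAMR μ x (AnalogMulticast.beamformer θ) h)
      (Real.logb 2 M)
      (AnalogMulticast.coopArrayGain x (AnalogMulticast.beamformer θ) R)
      K := by
  -- a single point of zero mean has no energy, and for `M = 0` the energy is `0 / 0 = 0`
  have hM : 2 ≤ M := by
    rcases M with _ | _ | M
    · simp at hx_energy
    · simp at hx_mean hx_energy
      simp [hx_mean] at hx_energy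
    · omega
  have : NeZero M := ⟨by omega⟩
  obtain ⟨n, rfl⟩ : ∃ n, K = n + 1 := ⟨K - 1, by omega⟩
  have hpos := AnalogMulticast.realMellin_mmse_pos x hM hx_inj n
  have hprod : 0 < ∏ k, AnalogMulticast.beamGain (AnalogMulticast.beamformer θ) (R k) :=
    Finset.prod_pos fun k _ => hgain k
  have hbase : 0 < ((n + 1).factorial : ℝ) *
      (∏ k, AnalogMulticast.beamGain (AnalogMulticast.beamformer θ) (R k)) /
      AnalogMulticast.realMellin (AnalogMulticast.mmse x) (((n + 1 : ℕ) : ℝ) + 1) := by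
    positivity
  have hd : 0 < AnalogMulticast.coopArrayGain x (AnalogMulticast.beamformer θ) R :=
    Real.rpow_pos_of_pos hbase _
  refine ⟨fun s hs => ⟨fun k => (h_gauss k).hasLaw_receivedSNR (hgain k) hs,
    h_indep.comp _ fun _ => AnalogMulticast.measurable_receivedSNR _ s⟩,
    fun γ hγ => (AnalogMulticast.hasDerivAt_constellationMI x hγ).differentiableAt, ?_, hpos, hd,
    hd, by positivity, ?_⟩
  · rw [AnalogMulticast.mellinIntegrand_natCast_add_one]
    exact AnalogMulticast.integrableOn_pow_mul_mmse x hx_inj (n + 1)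
  have hlim := (AnalogMulticast.tendsto_pow_mul_logb_sub_coopAMR hM x hx_inj hgain h_gauss
    h_indep).mul_const ((n + 1).factorial /
      AnalogMulticast.realMellin (AnalogMulticast.mmse x) (((n + 1 : ℕ) : ℝ) + 1))
  have hfac : ((n + 1).factorial : ℝ) ≠ 0 := by positivity
  rw [div_mul_div_cancel₀ hfac, div_self hpos.ne'] at hlim
  refine Asymptotics.isEquivalent_of_tendsto_one (hlim.congr' ?_)
  filter_upwards [eventually_gt_atTop 0] with s hs
  have hpow : (AnalogMulticast.coopArrayGain x (AnalogMulticast.beamformer θ) R * s) ^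
      (-((n + 1 : ℕ) : ℝ)) = (((n + 1).factorial : ℝ) *
      (∏ k, AnalogMulticast.beamGain (AnalogMulticast.beamformer θ) (R k)) /
      AnalogMulticast.realMellin (AnalogMulticast.mmse x) (((n + 1 : ℕ) : ℝ) + 1) *
      s ^ (n + 1))⁻¹ := by
    rw [Real.rpow_neg (by positivity), Real.rpow_natCast, mul_pow,
      AnalogMulticast.coopArrayGain, one_div,
      Real.rpow_inv_natCast_pow hbase.le (Nat.succ_ne_zero n)]
  rw [Pi.div_apply, hpow, div_inv_eq_mul]
  ring
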